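/- Let $m\ge 2$, $n=2^m-2$, and let $\mathbb F$ be the field with two elements. Let $L$ be the (Lie) algebra over $\mathbb F$ with basis $v(0),\dots,v(n-1),w,x$ and bilinear product given by $$v(i)\cdot v(j)=\binom{j+1}{n-i}\,v(i\oplus j),\qquad v(i)\cdot w=w\cdot v(i)=v(i+1)\ (0\le i\le n-2),\qquad v(n-1)\cdot w=w\cdot v(n-1)=w,$$ $$v(i)\cdot x=x\cdot v(i)=0,\qquad w\cdot x=x\cdot w=v(0),\qquad w\cdot w=x\cdot x=0,$$ where $i\oplus j\in\{0,\dots,n-2\}$ is congruent to $i+j$ modulo $n-1$. Let $W$ be the span of $v(0),\dots,v(n-1),w$; all products in $L$ lie in $W$. For each non-empty subset $A\subseteq\mathbb N$ let $W_A=\{z_A: z\in W\}$ be a copy of $W$, and let $$L^*=\Big(\bigoplus_{\emptyset\ne A\subseteq\mathbb N}W_A\Big)\oplus\mathbb F x$$ with the bilinear product determined by $z_A\cdot t_B=(z\cdot t)_{A\cup B}$ if $A\cap B=\emptyset$ and $z_A\cdot t_B=0$ otherwise, $z_A\cdot x=(z\cdot x)_A$, $x\cdot z_A=(x\cdot z)_A$,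 $x\cdot x=0$, for $z,t\in W$. For $y\in L^*$ let $\mathrm{ad}(y)$ be the linear operator $u\mapsto u\cdot y$ on $L^*$. For each of the basis elements $y=x,\ v(i)_A,\ w_A$ one has $\mathrm{ad}(y)^2=0$, so that $1+\mathrm{ad}(y)$ is invertible; let $G\le \mathrm{GL}(L^*)$ be the subgroup generated by $1+\mathrm{ad}(x)$ and all $1+\mathrm{ad}(v(i)_A)$ and $1+\mathrm{ad}(w_A)$, where $0\le i\le n-1$ and $\emptyset\neq A\subseteq\mathbb N$. Proposition 3.9. For every $r\ge 0$ and all $g_1,\dots,g_r\in G$, the subgroup $$H=\big\langle (1+\mathrm{ad}(x))^{g_1},\dots,(1+\mathrm{ad}(x))^{g_r}\big\rangle$$ of $G$, where $a^g=g^{-1}ag$, is nilpotent of class at most $4r+1$. On the other hand, the normal closure of $1+\mathrm{ad}(x)$ in $G$ is not nilpotent. -/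

import Mathlib

noncomputable section

namespace EngelLie

/-- Indices of the basis `v(0), …, v(n-1), w` of the vector space `W`. -/
inductive WIdx (n : ℕ) : Type
  | v (i : Fin n) : WIdx n
  | w : WIdx n

/-- The vector space `W = 𝔽₂ v(0) + ⋯ + 𝔽₂ v(n-1) + 𝔽₂ w`. -/
abbrev W (n : ℕ) : Type := WIdx n →₀ ZMod 2

/-- The basis vector `v(i)` or `w` of `W`. -/
def wBasis {n : ℕ} (a : WIdx n) : W n := Finsupp.single a 1

theorem oplus_lt {n : ℕ} (i j : Fin n) : ((i : ℕ) + (j : ℕ)) % (n - 1) < n := by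
  have hi := i.2
  have hj := j.2
  rcases Nat.eq_zero_or_pos (n - 1) with h | h
  · rw [h, Nat.mod_zero]; omega
  · exact (Nat.mod_lt _ h).trans_le (Nat.sub_le _ _)

/-- `i ⊕ j` is the representative of `i + j` modulo `n - 1` in `{0, …, n - 2}` (for `2 ≤ n`). -/
def oplus {n : ℕ} (i j : Fin n) : Fin n := ⟨((i : ℕ) + (j : ℕ)) % (n - 1), oplus_lt i j⟩

/-- The vector `v(i) · w = w · v(i)`: it is `v(i+1)` for `i ≤ n - 2`, and `w` for `i = n - 1`. -/
def vw {n : ℕ} (i : Fin n) : W n :=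
  if h : (i : ℕ) + 1 < n then wBasis (WIdx.v ⟨(i : ℕ) + 1, h⟩) else wBasis WIdx.w

/-- The vector `w · x = x · w = v(0)` (which exists as soon as `0 < n`). -/
def wx (n : ℕ) : W n :=
  if h : 0 < n then wBasis (WIdx.v ⟨0, h⟩) else 0

/-- The multiplication table of the algebra `L = W ⊕ 𝔽₂ x` on its basis, where `some a` stands for
the basis vector `a` of `W` and `none` stands for `x`. Every product of two basis vectors of `L`
lies in `W`, so the table takes its values in `W`. -/
def lMul {n : ℕ} : Option (WIdx n) → Option (WIdx n) → W n
  | some (WIdx.v i), some (WIdx.v j) =>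
      ((Nat.choose ((j : ℕ) + 1) (n - (i : ℕ)) : ℕ) : ZMod 2) • wBasis (WIdx.v (oplus i j))
  | some (WIdx.v i), some WIdx.w => vw i
  | some WIdx.w, some (WIdx.v i) => vw i
  | some WIdx.w, some WIdx.w => 0
  | some (WIdx.v _), none => 0
  | none, some (WIdx.v _) => 0
  | some WIdx.w, none => wx n
  | none, some WIdx.w => wx n
  | none, none => 0

/-- The non-empty subsets of `ℕ`. -/
abbrev NESet : Type := {A : Set ℕ // A.Nonempty}

/-- Indices of the basis of `L*`: `none` stands for `x`, and `some (A, a)` for the copy in `W_A` of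
the basis vector `a` of `W`, that is for `v(i)_A` or `w_A`. -/
abbrev LStarIdx (n : ℕ) : Type := Option (NESet × WIdx n)

/-- The vector space `L* = (⨁_{∅ ≠ A ⊆ ℕ} W_A) ⊕ 𝔽₂ x`. -/
abbrev LStar (n : ℕ) : Type := LStarIdx n →₀ ZMod 2

/-- The basis vectors `x`, `v(i)_A`, `w_A` of `L*`. -/
def starBasis {n : ℕ} (b : LStarIdx n) : LStar n := Finsupp.single b 1

/-- The embedding `z ↦ z_A` of `W` in `L*` with image `W_A`. -/
def copy {n : ℕ} (A : NESet) : W n →ₗ[ZMod 2] LStar n :=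
  Finsupp.lmapDomain (ZMod 2) (ZMod 2) fun a => some (A, a)

open Classical in
/-- The product of two basis vectors of `L*`: `z_A · t_B = (z · t)_{A ∪ B}` if `A` and `B` are
disjoint and `0` otherwise, `z_A · x = (z · x)_A`, `x · z_A = (x · z)_A` and `x · x = 0`. -/
def starMulBasis {n : ℕ} : LStarIdx n → LStarIdx n → LStar n
  | some (A, a), some (B, b) =>
      if Disjoint A.1 B.1 then
        copy ⟨A.1 ∪ B.1, A.2.mono Set.subset_union_left⟩ (lMul (some a) (some b))
      else 0
  | some (A, a), none => copy A (lMul (some a) none)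
  | none, some (A, a) => copy A (lMul none (some a))
  | none, none => 0

/-- The bilinear product of `L*`. -/
def starMul (n : ℕ) : LStar n →ₗ[ZMod 2] LStar n →ₗ[ZMod 2] LStar n :=
  Finsupp.lsum (ZMod 2) fun b =>
    (LinearMap.lsmul (ZMod 2) (LStar n →ₗ[ZMod 2] LStar n)).flip
      (Finsupp.linearCombination (ZMod 2) (starMulBasis b))

/-- Multiplication by `y` on the right, `u ↦ u · y`, as a linear operator on `L*`. -/
def ad {n : ℕ} (y : LStar n) : Module.End (ZMod 2) (LStar n) := (starMul n).flip y

theorem starMul_basis {n : ℕ} (b c : LStarIdx n) :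
    starMul n (starBasis b) (starBasis c) = starMulBasis b c := by
  simp [starMul, starBasis]

theorem ad_basis {n : ℕ} (b c : LStarIdx n) : ad (starBasis c) (starBasis b) = starMulBasis b c :=
  starMul_basis b c

theorem copy_wBasis {n : ℕ} (A : NESet) (a : WIdx n) : copy A (wBasis a) = starBasis (some (A, a)) := by
  simp [copy, wBasis, starBasis, Finsupp.mapDomain_single]

/-- Multiplying an element of `W_A` by an element of `W_B` gives `0` if `A` and `B` meet. -/
theorem ad_copy_of_not_disjoint {n : ℕ} {A B : NESet} (h : ¬ Disjoint A.1 B.1) (z : W n)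
    (b : WIdx n) : ad (starBasis (some (B, b))) (copy A z) = 0 := by
  induction z using Finsupp.induction_linear with
  | zero => simp
  | add f g hf hg => rw [map_add, map_add, hf, hg, add_zero]
  | single a c =>
    have : (Finsupp.single a c : W n) = c • wBasis a := by simp [wBasis]
    rw [this, map_smul, map_smul, copy_wBasis, ad_basis]
    simp [starMulBasis, h]

theorem ad_x_copy_wx {n : ℕ} (A : NESet) : ad (starBasis none) (copy A (wx n)) = 0 := by
  unfold wx
  split_ifs
  · rw [copy_wBasis, ad_basis]; simp [starMulBasis, lMul]
  · simp

/-- The square of `ad(b)` is zero for each basis vector `b` of `L*`. -/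
theorem ad_basis_sq {n : ℕ} (b : LStarIdx n) : ad (starBasis b) * ad (starBasis b) = 0 := by
  refine Finsupp.lhom_ext fun c t => ?_
  have ht : (Finsupp.single c t : LStar n) = t • starBasis c := by simp [starBasis]
  rw [ht, map_smul, Module.End.mul_apply, ad_basis, LinearMap.zero_apply]
  suffices h : ad (starBasis b) (starMulBasis c b) = 0 by rw [h, smul_zero]
  rcases b with _ | ⟨B, b⟩
  · rcases c with _ | ⟨A, _ | _⟩
    · simp [starMulBasis]
    · simp [starMulBasis, lMul]
    · simpa [starMulBasis, lMul] using ad_x_copy_wx A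
  · have hB : B.1 ≠ ∅ := B.2.ne_empty
    rcases c with _ | ⟨A, a⟩
    · exact ad_copy_of_not_disjoint (by simpa using hB) _ _
    · by_cases h : Disjoint A.1 B.1
      · simp only [starMulBasis, h, if_true]
        refine ad_copy_of_not_disjoint ?_ _ _
        simp [Set.disjoint_union_left, hB]
      · simp [starMulBasis, h]

/-- `1 + ad(b)` is an involution for each basis vector `b` of `L*`. -/
theorem one_add_ad_sq {n : ℕ} (b : LStarIdx n) :
    (1 + ad (starBasis b)) * (1 + ad (starBasis b)) = 1 := by
  have h2 : ad (starBasis b) + ad (starBasis b) = 0 := by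
    rw [← two_smul (ZMod 2) (ad (starBasis b)), show (2 : ZMod 2) = 0 from rfl, zero_smul]
  rw [add_mul, one_mul, mul_add, mul_one, ad_basis_sq, add_zero, add_assoc, h2, add_zero]

/-- The invertible operator `1 + ad(b)` of `L*`, for a basis vector `b` of `L*`. -/
def oneAddAd {n : ℕ} (b : LStarIdx n) : LinearMap.GeneralLinearGroup (ZMod 2) (LStar n) where
  val := 1 + ad (starBasis b)
  inv := 1 + ad (starBasis b)
  val_inv := one_add_ad_sq b
  inv_val := one_add_ad_sq b

/-- The subgroup `G` of `GL(L*)` generated by `1 + ad(x)` and all `1 + ad(v(i)_A)`, `1 + ad(w_A)`,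
where `0 ≤ i ≤ n - 1` and `A` runs over the non-empty subsets of `ℕ`. -/
def G (n : ℕ) : Subgroup (LinearMap.GeneralLinearGroup (ZMod 2) (LStar n)) :=
  Subgroup.closure (Set.range oneAddAd)

/-- The element `1 + ad(x)` of `G`. -/
def oneAddAdX (n : ℕ) : G n := ⟨oneAddAd none, Subgroup.subset_closure ⟨none, rfl⟩⟩

end EngelLie

end

noncomputable section
namespace EngelLie

open scoped commutatorElement

/-! ### Binomial coefficients modulo two -/

/-! Put N = n + 1 = 2^m - 1 and R = `SetRing`. Sending x to f(N), v(i)_A to A f(n - i) and w_A to A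
f(0) embeds L* in a Witt algebra over R (`toWitt_injective`, `toWitt_ad_starBasis`), where f(q) =
t^(q) ∂ is a vector field on a divided power line and, modulo 2, f(q) f(p) = C(p + q, p) f(p + q -
1).

In this model ad(x) has rank one: it takes the value at t = 0 and multiplies it by f(N - 1), the
derivative of the Dirac function f(N) at 0. A general point is a divided power sequence γ, with γ(a)
the value of t^(a). Conjugation by 1 + ad(s f(p)) moves the point along s f(p) and multiplies both
the value and the Dirac derivative by the Jacobian 1 + s γ(p - 1), whose square is 1. So every
conjugate of ad(x) is an evaluation of the same kind at some point (`IsEvaluation.conj`).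

With r conjugates only r points γ_k occur. A product of l of the operators contains l - 1 scalars,
each a sum of terms γ_j(a) γ_k(b) with a + b = n. As γ_k(a) γ_k(b) = 0 when a, b ≤ N < a + b,
monomials of total degree above rN vanish, so the product is 0 once (l - 1) n > r (n + 1)
(`prod_evaluations_eq_zero`). Commutators multiply the numbers of factors as in a filtered ring,
which bounds the class (`lowerCentralSeries_closure_eq_bot`).

For the second claim, commuting with 1 + ad(w_C) turns f(p + 1) into f(p) (`commutator_gen`). An
infinite A splits into two infinite parts again and again, so this puts 1 + ad(w_A) first in the
normal closure and then in every term of its lower central series. -/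

theorem odd_choose_two_pow_sub_one {N m : ℕ} (hN : N + 1 = 2 ^ m) {k : ℕ} (hk : k ≤ N) :
    Odd (N.choose k) := by
  induction k with
  | zero => simp
  | succ k ih =>
    have h1 : 2 ∣ (N + 1).choose (k + 1) := by
      rw [hN]
      exact Nat.prime_two.dvd_choose_pow (by omega) (by omega)
    rw [Nat.choose_succ_succ] at h1
    have h2 := ih (by omega)
    rcases Nat.even_or_odd (N.choose (k + 1)) with h | h
    · exact absurd (even_iff_two_dvd.mpr h1) (Nat.not_even_iff_odd.mpr (h2.add_even h))
    · exact h

/-- Vandermonde's identity for a + b = 2^m + e: each C(2^m, i) with 0 < i < 2^m is even, and the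
term i = 0 vanishes because e < a. -/
theorem even_choose_of_lt_two_pow_le {M m : ℕ} (hM : M = 2 ^ m) {a b : ℕ} (ha : a < M) (hb : b < M)
    (hab : M ≤ a + b) : Even ((a + b).choose a) := by
  obtain ⟨e, he⟩ := Nat.exists_eq_add_of_le hab
  rw [he, Nat.add_choose_eq, even_iff_two_dvd]
  refine Finset.dvd_sum fun ij hij => ?_
  rw [Finset.HasAntidiagonal.mem_antidiagonal] at hij
  rcases Nat.eq_zero_or_pos ij.1 with h | h
  · rw [Nat.choose_eq_zero_of_lt (show e < ij.2 by omega), mul_zero]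
    exact dvd_zero _
  · refine Dvd.dvd.mul_right ?_ _
    rw [hM]
    exact Nat.prime_two.dvd_choose_pow (by omega) (by omega)

/-- Complementing the bits of `p` below `m`: `C(N - p, l)` and `C(p + l, p)` have the same parity
for `N = 2 ^ m - 1`. -/
theorem cast_choose_sub {R : Type*} [CommRing R] [CharP R 2] {N m : ℕ} (hN : N + 1 = 2 ^ m)
    {p l : ℕ} (hp : p ≤ N) (hl : l ≤ N) :
    (((N - p).choose l : ℕ) : R) = ((p + l).choose p : ℕ) := by
  have hodd : ∀ k ≤ N, ((N.choose k : ℕ) : R) = 1 := fun k hk => by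
    obtain ⟨t, ht⟩ := odd_choose_two_pow_sub_one hN hk
    rw [ht]
    push_cast
    rw [CharTwo.two_eq_zero, zero_mul, zero_add]
  rcases le_or_gt (p + l) N with h | h
  -- C(N, p + l) C(p + l, p) = C(N, p) C(N - p, l), and both C(N, ·) are odd.
  · have := Nat.choose_mul (n := N) (k := p + l) (s := p) (Nat.le_add_right p l)
    rw [Nat.add_sub_cancel_left] at this
    have := congrArg (Nat.cast (R := R)) this
    push_cast at this
    rw [hodd _ h, hodd _ hp, one_mul, one_mul] at this
    exact this.symm
  · rw [Nat.choose_eq_zero_of_lt (by omega), Nat.cast_zero]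
    obtain ⟨t, ht⟩ := even_choose_of_lt_two_pow_le hN (a := p) (b := l) (by omega) (by omega)
      (by omega)
    rw [ht]
    push_cast
    rw [CharTwo.add_self_eq_zero]

/-! ### The coefficient ring -/

/-- The ideal of the polynomial-like ring `𝔽₂[ℕ → ℕ]` spanned by the monomials that are divisible
by the square of a variable. -/
def squareIdeal : Ideal (AddMonoidAlgebra (ZMod 2) (ℕ → ℕ)) where
  carrier := {f | ∀ φ : ℕ → ℕ, (∀ i, φ i ≤ 1) → f.coeff φ = 0}
  add_mem' hf hg φ hφ := by
    simp [hf φ hφ, hg φ hφ]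
  zero_mem' φ _ := by simp
  smul_mem' c f hf φ hφ := by
    classical
    rw [smul_eq_mul, AddMonoidAlgebra.mul_def, AddMonoidAlgebra.coeff_finsuppSum,
      Finsupp.sum_apply]
    refine Finset.sum_eq_zero fun a _ => ?_
    dsimp only
    rw [AddMonoidAlgebra.coeff_finsuppSum, Finsupp.sum_apply]
    refine Finset.sum_eq_zero fun b _ => ?_
    dsimp only
    rw [AddMonoidAlgebra.coeff_single, Finsupp.single_apply]
    split_ifs with h
    · rw [hf b fun i => ?_, mul_zero]
      have := hφ i
      rw [← h, Pi.add_apply] at this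
      omega
    · rfl

/-- The commutative ring with basis the sets `A ⊆ ℕ`, where the product of `A` and `B` is `A ∪ B` if
`A` and `B` are disjoint, and `0` otherwise. -/
def SetRing : Type := AddMonoidAlgebra (ZMod 2) (ℕ → ℕ) ⧸ squareIdeal

instance : CommRing SetRing :=
  inferInstanceAs (CommRing (AddMonoidAlgebra (ZMod 2) (ℕ → ℕ) ⧸ squareIdeal))

instance : Algebra (ZMod 2) SetRing :=
  inferInstanceAs (Algebra (ZMod 2) (AddMonoidAlgebra (ZMod 2) (ℕ → ℕ) ⧸ squareIdeal))

/-- The projection to `SetRing`. -/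
def SetRing.mk : AddMonoidAlgebra (ZMod 2) (ℕ → ℕ) →+* SetRing := Ideal.Quotient.mk squareIdeal

theorem SetRing.mk_eq_zero_iff {f : AddMonoidAlgebra (ZMod 2) (ℕ → ℕ)} :
    SetRing.mk f = 0 ↔ f ∈ squareIdeal := Ideal.Quotient.eq_zero_iff_mem

open Classical in
/-- The basis vector of `SetRing` that belongs to `A`. -/
def setVar (A : Set ℕ) : SetRing :=
  SetRing.mk (AddMonoidAlgebra.single (A.indicator 1) 1)

instance : CharP SetRing 2 := by
  refine CharTwo.of_one_ne_zero_of_two_eq_zero ?_ ?_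
  · rw [Ne, ← map_one SetRing.mk, SetRing.mk_eq_zero_iff]
    intro h
    have := h 0 (by simp)
    simp [AddMonoidAlgebra.one_def] at this
  · have : (2 : AddMonoidAlgebra (ZMod 2) (ℕ → ℕ)) = 0 := by
      have := map_ofNat (algebraMap (ZMod 2) (AddMonoidAlgebra (ZMod 2) (ℕ → ℕ))) 2
      rw [← this, show (OfNat.ofNat 2 : ZMod 2) = 0 from rfl, map_zero]
    have h2 := map_ofNat SetRing.mk 2
    rw [← h2, show (OfNat.ofNat 2 : AddMonoidAlgebra (ZMod 2) (ℕ → ℕ)) = 0 from this, map_zero]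

theorem setVar_empty : setVar ∅ = 1 := by
  rw [setVar, Set.indicator_empty', ← map_one SetRing.mk]
  rfl

theorem setVar_mul_of_disjoint {A B : Set ℕ} (h : Disjoint A B) :
    setVar A * setVar B = setVar (A ∪ B) := by
  rw [setVar, setVar, setVar, ← map_mul, AddMonoidAlgebra.single_mul_single, mul_one,
    Set.indicator_union_of_disjoint h]
  rfl

theorem setVar_mul_of_not_disjoint {A B : Set ℕ} (h : ¬ Disjoint A B) :
    setVar A * setVar B = 0 := by
  classical
  rw [setVar, setVar, ← map_mul, AddMonoidAlgebra.single_mul_single, mul_one,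
    SetRing.mk_eq_zero_iff]
  intro φ hφ
  rw [AddMonoidAlgebra.coeff_single, Finsupp.single_apply, if_neg]
  rintro rfl
  obtain ⟨i, hA, hB⟩ := Set.not_disjoint_iff.mp h
  have := hφ i
  simp [hA, hB] at this

/-- The coordinate of an element of `SetRing` at the basis vector that belongs to `A`. -/
def setCoeff (A : Set ℕ) : SetRing →+ ZMod 2 :=
  QuotientAddGroup.lift squareIdeal.toAddSubgroup
    ((Finsupp.applyAddHom (A.indicator 1)).comp
      (AddMonoidAlgebra.coeffAddEquiv (R := ZMod 2) (M := ℕ → ℕ)).toAddMonoidHom)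
    fun f hf => hf _ fun i => by
      classical
      rw [Set.indicator_apply]
      split_ifs <;> simp

open Classical in
theorem setCoeff_setVar (A B : Set ℕ) : setCoeff A (setVar B) = if A = B then 1 else 0 := by
  have h : setCoeff A (setVar B) =
      (AddMonoidAlgebra.single (B.indicator (1 : ℕ → ℕ)) (1 : ZMod 2)).coeff (A.indicator 1) := rfl
  rw [h, AddMonoidAlgebra.coeff_single, Finsupp.single_apply]
  refine if_congr ⟨fun h => ?_, fun h => by rw [h]⟩ rfl rfl
  ext i
  have := congrFun h i
  by_cases h1 : i ∈ A <;> by_cases h2 : i ∈ B <;> simp [h1, h2] at this ⊢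

/-! ### The Witt algebra in characteristic two -/

section Witt

variable {R : Type*} [CommRing R]

/-- Right multiplication by `s f(p)` in the Witt algebra with basis `f(0), …, f(N)` over a ring of
characteristic two, in which `f(q) f(p) = C(N - p, q) f(q + p - 1)`, where `N = 2 ^ m - 1`. -/
def wittMul (N p : ℕ) (s : R) : (ℕ →₀ R) →ₗ[R] (ℕ →₀ R) :=
  Finsupp.linearCombination R fun q =>
    if q + p = 0 then 0 else Finsupp.single (q + p - 1) (s * ((N - p).choose q : ℕ))

theorem wittMul_single (N p : ℕ) (s : R) (q : ℕ) (e : R) :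
    wittMul N p s (Finsupp.single q e) =
      if q + p = 0 then 0 else Finsupp.single (q + p - 1) (e * (s * ((N - p).choose q : ℕ))) := by
  rw [wittMul, Finsupp.linearCombination_single]
  split_ifs
  · rw [smul_zero]
  · rw [Finsupp.smul_single, smul_eq_mul]

end Witt

/-! ### Comparison of `L*` with the Witt algebra over `SetRing` -/

/-- The index `p` for which the basis vector of `L*` is a multiple of `f(p)`. -/
def starDeg {n : ℕ} : LStarIdx n → ℕ
  | none => n + 1
  | some (_, WIdx.v i) => n - i
  | some (_, WIdx.w) => 0

/-- The coefficient in `SetRing` of a basis vector of `L*`. -/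
def starCoeff {n : ℕ} : LStarIdx n → SetRing
  | none => 1
  | some (A, _) => setVar A.1

/-- The embedding of `L*` in the Witt algebra over `SetRing`. -/
def toWitt (n : ℕ) : LStar n →ₗ[ZMod 2] (ℕ →₀ SetRing) :=
  Finsupp.linearCombination (ZMod 2) fun b => Finsupp.single (starDeg b) (starCoeff b)

theorem toWitt_starBasis {n : ℕ} (b : LStarIdx n) :
    toWitt n (starBasis b) = Finsupp.single (starDeg b) (starCoeff b) := by
  rw [toWitt, starBasis, Finsupp.linearCombination_single, one_smul]

/-- Degree and set together determine a basis vector (x has degree n + 1 and the empty set), so each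
coordinate of L* is a coordinate of the image. -/
theorem toWitt_injective (n : ℕ) : Function.Injective (toWitt n) := by
  classical
  rw [injective_iff_map_eq_zero]
  intro u hu
  have key : ∀ c : LStarIdx n, ∃ A : Set ℕ, ∀ b : LStarIdx n,
      setCoeff A ((Finsupp.single (starDeg b) (starCoeff b) : ℕ →₀ SetRing) (starDeg c)) =
        if b = c then 1 else 0 := by
    rintro (_ | ⟨C, c⟩)
    · refine ⟨∅, ?_⟩
      rintro (_ | ⟨B, b⟩)
      · simp [starCoeff, ← setVar_empty, setCoeff_setVar]
      · rw [Finsupp.single_apply]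
        split_ifs <;> simp_all [starCoeff, setCoeff_setVar, B.2.ne_empty.symm]
    · refine ⟨C.1, ?_⟩
      rintro (_ | ⟨B, b⟩)
      · rw [Finsupp.single_apply]
        split_ifs <;> simp_all [starCoeff, ← setVar_empty, setCoeff_setVar, C.2.ne_empty]
      · have hbc : starDeg (some (B, b)) = starDeg (some (C, c)) ↔ b = c := by
          rcases b with b | _ <;> rcases c with c | _ <;>
            simp [starDeg, Fin.ext_iff] <;> omega
        rw [Finsupp.single_apply, apply_ite (setCoeff C.1), starCoeff, setCoeff_setVar, map_zero,
          ← ite_and]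
        refine if_congr ?_ rfl rfl
        rw [hbc, Option.some_inj, Prod.mk.injEq, Subtype.ext_iff, and_comm, eq_comm (a := C.1)]
  ext c
  obtain ⟨A, hA⟩ := key c
  have h : (setCoeff A).comp ((Finsupp.applyAddHom (starDeg c)).comp (toWitt n).toAddMonoidHom) =
      Finsupp.applyAddHom c := by
    refine Finsupp.addHom_ext fun b t => ?_
    have ht : t = 0 ∨ t = 1 := by
      revert t
      decide
    rcases ht with rfl | rfl
    · simp
    · have := hA b
      rw [← toWitt_starBasis] at this
      simpa [Finsupp.single_apply, starBasis] using this
  have := DFunLike.congr_fun h u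
  simpa [hu] using this.symm

theorem toWitt_copy_wBasis {n : ℕ} (A : NESet) (a : WIdx n) :
    toWitt n (copy A (wBasis a)) = Finsupp.single (starDeg (some (A, a))) (setVar A.1) := by
  rw [copy_wBasis, toWitt_starBasis]
  rfl

theorem toWitt_copy_vw {n : ℕ} (A : NESet) (i : Fin n) :
    toWitt n (copy A (vw i)) = Finsupp.single (n - i - 1) (setVar A.1) := by
  rw [vw]
  split_ifs with h
  · rw [toWitt_copy_wBasis]
    rfl
  · rw [toWitt_copy_wBasis, show n - i - 1 = 0 by omega]
    rfl

theorem natCast_smul_setRing (k : ℕ) (f : ℕ →₀ SetRing) : (k : ZMod 2) • f = (k : SetRing) • f := by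
  rw [Nat.cast_smul_eq_nsmul, Nat.cast_smul_eq_nsmul]

theorem choose_top_eq_one {n m : ℕ} (hn : n + 2 = 2 ^ m) {k : ℕ} (hk : k ≤ n + 1) :
    (((n + 1).choose k : ℕ) : SetRing) = 1 := by
  have := cast_choose_sub (R := SetRing) hn (p := 0) (Nat.zero_le _) hk
  simpa using this

theorem toWitt_copy_lMul {n m : ℕ} (hn : n + 2 = 2 ^ m) (hm : 2 ≤ m) (A : NESet) (a b : WIdx n) :
    toWitt n (copy A (lMul (some a) (some b))) =
      if starDeg (some (A, a)) + starDeg (some (A, b)) = 0 then 0 else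
        Finsupp.single (starDeg (some (A, a)) + starDeg (some (A, b)) - 1)
          (setVar A.1 * ((n + 1 - starDeg (some (A, b))).choose (starDeg (some (A, a))) : ℕ)) := by
  have h4 : 2 ^ 2 ≤ 2 ^ m := Nat.pow_le_pow_right (by norm_num) hm
  rcases a with i | _ <;> rcases b with j | _
  · have hi := i.2
    have hj := j.2
    rw [if_neg (by simp only [starDeg]; omega)]
    simp only [lMul, starDeg]
    rw [map_smul, map_smul, toWitt_copy_wBasis, natCast_smul_setRing,
      Finsupp.smul_single, smul_eq_mul, mul_comm, show n + 1 - (n - (j : ℕ)) = j + 1 by omega]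
    simp only [starDeg, oplus]
    rcases lt_or_ge ((j : ℕ) + 1) (n - i) with h | h
    · rw [Nat.choose_eq_zero_of_lt h]
      simp
    -- For i = j = n - 1 the index i ⊕ j = 0 disagrees with the degree in the Witt algebra, but the
    -- coefficient C(n, 1) = n is even. In all other cases with nonzero coefficient, n - 1 ≤ i + j <
    -- 2(n - 1), so reduction subtracts n - 1 exactly once.
    · by_cases h2 : (i : ℕ) + j = 2 * (n - 1)
      · have hi' : (i : ℕ) = n - 1 := by omega
        have hj' : (j : ℕ) = n - 1 := by omega
        have hev : ((n : ℕ) : SetRing) = 0 := by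
          rw [CharP.cast_eq_zero_iff SetRing 2]
          rcases m with _ | m
          · omega
          · rw [pow_succ] at hn
            omega
        rw [hi', hj', show n - 1 + 1 = n by omega, show n - (n - 1) = 1 by omega,
          Nat.choose_one_right, hev]
        simp
      · rw [show (i : ℕ) + j = (i + j - (n - 1)) + (n - 1) by omega, Nat.add_mod_right,
          Nat.mod_eq_of_lt (by omega)]
        congr 1
        omega
  · have hi := i.2
    rw [if_neg (by simp only [starDeg]; omega)]
    simp only [lMul, starDeg]
    rw [toWitt_copy_vw, Nat.sub_zero, choose_top_eq_one hn (by omega), mul_one,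
      add_zero]
  · have hj := j.2
    rw [if_neg (by simp only [starDeg]; omega)]
    simp only [lMul, starDeg]
    rw [toWitt_copy_vw, Nat.choose_zero_right, Nat.cast_one, mul_one, zero_add]
  · simp [lMul, starDeg]

theorem toWitt_ad_starBasis {n m : ℕ} (hn : n + 2 = 2 ^ m) (hm : 2 ≤ m) (c : LStarIdx n)
    (u : LStar n) :
    toWitt n (ad (starBasis c) u) = wittMul (n + 1) (starDeg c) (starCoeff c) (toWitt n u) := by
  have h4 : 2 ^ 2 ≤ 2 ^ m := Nat.pow_le_pow_right (by norm_num) hm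
  induction u using Finsupp.induction_linear with
  | zero => simp
  | add f g hf hg => simp only [map_add, hf, hg]
  | single b t =>
    have ht : t = 0 ∨ t = 1 := by
      revert t
      decide
    rcases ht with rfl | rfl
    · simp
    change toWitt n (ad (starBasis c) (starBasis b)) = wittMul _ _ _ (toWitt n (starBasis b))
    rw [ad_basis, toWitt_starBasis, wittMul_single]
    have hwx : ∀ A : NESet, toWitt n (copy A (wx n)) = Finsupp.single n (setVar A.1) := fun A => by
      rw [wx, dif_pos (by omega), toWitt_copy_wBasis]
      rfl
    rcases b with _ | ⟨B, b⟩ <;> rcases c with _ | ⟨C, c⟩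
    · simp [starMulBasis, starDeg]
    · rcases c with j | _
      · have hj := j.2
        rw [if_neg (by simp only [starDeg]; omega)]
        simp only [starMulBasis, lMul, starDeg]
        rw [Nat.choose_eq_zero_of_lt (by omega)]
        simp
      · simp [starMulBasis, lMul, starDeg, starCoeff, hwx]
    · rcases b with j | _
      · have hj := j.2
        rw [if_neg (by simp only [starDeg]; omega)]
        simp only [starMulBasis, lMul, starDeg]
        rw [Nat.choose_eq_zero_of_lt (by omega)]
        simp
      · simp [starMulBasis, lMul, starDeg, starCoeff, hwx]
    · simp only [starMulBasis, starCoeff]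
      rw [← mul_assoc]
      by_cases h : Disjoint B.1 C.1
      · rw [if_pos h, toWitt_copy_lMul hn hm, setVar_mul_of_disjoint h]
        rcases b with _ | _ <;> rcases c with _ | _ <;> rfl
      · rw [if_neg h, setVar_mul_of_not_disjoint h, zero_mul, Finsupp.single_zero, map_zero, ite_self]

/-! ### Divided power sequences -/

section DividedPower

variable {R : Type*} [CommRing R]

/-- The values of the divided powers of a variable under a ring homomorphism to `R`. -/
structure IsDividedPower (γ : ℕ → R) : Prop where
  zero : γ 0 = 1
  mul : ∀ a b, γ a * γ b = ((a + b).choose a : ℕ) * γ (a + b)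

/-- The sequence `0, γ(0), γ(1), …`. -/
def delay (γ : ℕ → R) (a : ℕ) : R := if a = 0 then 0 else γ (a - 1)

@[simp] theorem delay_zero (γ : ℕ → R) : delay γ 0 = 0 := rfl

@[simp] theorem delay_succ (γ : ℕ → R) (a : ℕ) : delay γ (a + 1) = γ a := rfl

theorem isDividedPower_single : IsDividedPower (Pi.single 0 1 : ℕ → R) := by
  refine ⟨by simp, fun a b => ?_⟩
  rcases a with _ | a <;> rcases b with _ | b <;> simp

/-- The sequence `γ(a) + ε γ(a - 1)`. -/
def translate (γ : ℕ → R) (ε : R) (a : ℕ) : R := γ a + ε * delay γ a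

/-- `delay γ` is evaluation after differentiation, t^(a) ↦ t^(a - 1); this is the product rule, and
amounts to Pascal's rule. -/
theorem IsDividedPower.leibniz {γ : ℕ → R} (h : IsDividedPower γ) (a b : ℕ) :
    γ a * delay γ b + delay γ a * γ b = ((a + b).choose a : ℕ) * delay γ (a + b) := by
  rcases a with _ | a <;> rcases b with _ | b
  · simp
  · simp [h.zero]
  · simp [h.zero]
  · have h1 := h.mul (a + 1) b
    have h2 := h.mul a (b + 1)
    rw [delay_succ, delay_succ, h1, h2, show a + 1 + (b + 1) = (a + b + 1) + 1 by ring, delay_succ,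
      show a + 1 + b = a + b + 1 by ring, show a + (b + 1) = a + b + 1 by ring,
      Nat.choose_succ_succ (a + b + 1) a]
    push_cast
    ring

/-- A first-order displacement of the point: the linear term is the product rule and the quadratic
one carries ε² = 0. -/
theorem IsDividedPower.translate {γ : ℕ → R} (h : IsDividedPower γ) {ε : R} (hε : ε * ε = 0) :
    IsDividedPower (translate γ ε) := by
  refine ⟨by simp [EngelLie.translate, h.zero], fun a b => ?_⟩
  rw [EngelLie.translate, EngelLie.translate, EngelLie.translate]
  linear_combination h.mul a b + ε * h.leibniz a b + delay γ a * delay γ b * hε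

variable [CharP R 2]

theorem IsDividedPower.mul_eq_zero {γ : ℕ → R} (h : IsDividedPower γ) {N m : ℕ}
    (hN : N + 1 = 2 ^ m) {a b : ℕ} (ha : a ≤ N) (hb : b ≤ N) (hab : N < a + b) :
    γ a * γ b = 0 := by
  rw [h.mul, ← cast_choose_sub hN ha hb, Nat.choose_eq_zero_of_lt (by omega), Nat.cast_zero,
    zero_mul]

/-- Modulo 2, C(N - p, l) is C(p + l, p), the coefficient in the product rule. This ties the
structure constants of the algebra to evaluations. -/
theorem IsDividedPower.choose_mul_delay {γ : ℕ → R} (h : IsDividedPower γ) {N m : ℕ}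
    (hN : N + 1 = 2 ^ m) {p l : ℕ} (hp : p ≤ N) (hl : l ≤ N) :
    ((N - p).choose l : ℕ) * delay γ (p + l) = γ p * delay γ l + delay γ p * γ l := by
  rw [h.leibniz, cast_choose_sub hN hp hl]

end DividedPower

/-! ### Evaluations -/

section Evaluation

variable {R : Type*} [CommRing R]

/-- The functional `f(q) ↦ γ(q)`. -/
def evalAt (γ : ℕ → R) : (ℕ →₀ R) →ₗ[R] R := Finsupp.linearCombination R γ

theorem evalAt_single (γ : ℕ → R) (q : ℕ) (e : R) : evalAt γ (Finsupp.single q e) = e * γ q := by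
  rw [evalAt, Finsupp.linearCombination_single, smul_eq_mul]

/-- The derivative `∑ γ(b) f(N - 1 - b)` of the element `∑ γ(b) f(N - b)`. -/
def diracDeriv (N : ℕ) (γ : ℕ → R) : ℕ →₀ R :=
  ∑ b ∈ Finset.range N, Finsupp.single (N - 1 - b) (γ b)

theorem evalAt_diracDeriv (N : ℕ) (γ γ' : ℕ → R) :
    evalAt γ' (diracDeriv N γ) = ∑ b ∈ Finset.range N, γ b * γ' (N - 1 - b) := by
  simp only [diracDeriv, map_sum, evalAt_single]

theorem wittMul_diracDeriv {N p : ℕ} (hp : p ≤ N) (s : R) (γ : ℕ → R) :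
    wittMul N p s (diracDeriv N γ) = ∑ l ∈ Finset.range N,
      Finsupp.single (N - 1 - l) (s * (((N - p).choose l : ℕ) * delay γ (p + l))) := by
  rw [diracDeriv, map_sum]
  simp only [wittMul_single]
  have hl : ∀ b, (if N - 1 - b + p = 0 then (0 : ℕ →₀ R) else Finsupp.single (N - 1 - b + p - 1)
      (γ b * (s * ((N - p).choose (N - 1 - b) : ℕ)))) ≠ 0 → N - 1 - b + p ≠ 0 ∧
        N - 1 - b ≤ N - p := fun b hb => by
    refine ⟨fun h => hb (if_pos h), ?_⟩
    by_contra h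
    rw [Nat.choose_eq_zero_of_lt (by omega)] at hb
    simp at hb
  -- The reindexing l = b + 1 - p is meaningful only where the subtractions do not truncate, which
  -- holds for the nonzero terms.
  refine Finset.sum_bij_ne_zero (fun b _ _ => b + 1 - p) ?_ ?_ ?_ ?_
  · intro b hb h0
    have := hl b h0
    rw [Finset.mem_range] at hb ⊢
    omega
  · intro b hb h0 b' hb' h0' h
    have := hl b h0
    have := hl b' h0'
    rw [Finset.mem_range] at hb hb'
    omega
  · intro l hlN h0
    rw [Finset.mem_range] at hlN
    have h1 : p + l ≠ 0 := fun h => by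
      rw [h] at h0
      simp at h0
    have h2 : l ≤ N - p := by
      by_contra h
      rw [Nat.choose_eq_zero_of_lt (by omega)] at h0
      simp at h0
    refine ⟨p + l - 1, Finset.mem_range.mpr (by omega), ?_, by omega⟩
    rw [if_neg (by omega), show N - 1 - (p + l - 1) + p - 1 = N - 1 - l by omega,
      show N - 1 - (p + l - 1) = N - p - l by omega, Nat.choose_symm h2]
    convert h0 using 2
    rw [delay, if_neg h1]
    ring
  · intro b hb h0
    have := hl b h0
    rw [Finset.mem_range] at hb
    rw [if_neg this.1, delay, if_neg (by omega), show p + (b + 1 - p) - 1 = b by omega,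
      show N - 1 - b + p - 1 = N - 1 - (b + 1 - p) by omega,
      show N - 1 - b = N - p - (b + 1 - p) by omega, Nat.choose_symm (by omega)]
    congr 1
    ring

variable [CharP R 2] {N m p : ℕ} {s : R} {γ : ℕ → R}

/-- Expanding the right side gives the product rule to first order in s; `hs` kills the term in s².
-/
theorem IsDividedPower.evalAt_add_wittMul (h : IsDividedPower γ) (hN : N + 1 = 2 ^ m) (hp : p ≤ N)
    (hs : s * s * (γ p * delay γ p) = 0) {q : ℕ} (hq : q ≤ N) (e : R) :
    evalAt γ (Finsupp.single q e + wittMul N p s (Finsupp.single q e)) =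
      (1 + s * delay γ p) * evalAt (EngelLie.translate γ (s * γ p)) (Finsupp.single q e) := by
  have h1 : evalAt γ (wittMul N p s (Finsupp.single q e)) =
      e * (s * (((N - p).choose q : ℕ) * delay γ (p + q))) := by
    rw [wittMul_single]
    split_ifs with h0
    · rw [add_comm, h0]
      simp
    · rw [evalAt_single, delay, if_neg (by omega), add_comm q p]
      ring
  rw [map_add, h1, h.choose_mul_delay hN hp hq, evalAt_single, evalAt_single, EngelLie.translate]
  linear_combination - e * delay γ q * hs

theorem IsDividedPower.diracDeriv_add_wittMul (h : IsDividedPower γ) (hN : N + 1 = 2 ^ m)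
    (hp : p ≤ N) (hs : s * s * (γ p * delay γ p) = 0) :
    diracDeriv N γ + wittMul N p s (diracDeriv N γ) =
      (1 + s * delay γ p) • diracDeriv N (EngelLie.translate γ (s * γ p)) := by
  rw [wittMul_diracDeriv hp, diracDeriv, diracDeriv, Finset.smul_sum, ← Finset.sum_add_distrib]
  refine Finset.sum_congr rfl fun l hl => ?_
  rw [Finset.mem_range] at hl
  rw [h.choose_mul_delay hN hp (by omega), ← Finsupp.single_add, Finsupp.smul_single, smul_eq_mul,
    EngelLie.translate]
  congr 1
  linear_combination - delay γ l * hs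

end Evaluation

/-- The operator `T` of `L*` is `u ↦ γ(u) ∑ γ(b) f(n - b)` on the Witt algebra. -/
def IsEvaluation {n : ℕ} (T : Module.End (ZMod 2) (LStar n)) (γ : ℕ → SetRing) : Prop :=
  ∀ u, toWitt n (T u) = evalAt γ (toWitt n u) • diracDeriv (n + 1) γ

theorem starDeg_le {n : ℕ} (b : LStarIdx n) : starDeg b ≤ n + 1 := by
  rcases b with _ | ⟨A, i | _⟩ <;> simp only [starDeg] <;> omega

theorem isEvaluation_ad_x {n m : ℕ} (hn : n + 2 = 2 ^ m) (hm : 2 ≤ m) :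
    IsEvaluation (ad (starBasis (none : LStarIdx n))) (Pi.single 0 1) := by
  intro u
  rw [toWitt_ad_starBasis hn hm]
  generalize toWitt n u = f
  induction f using Finsupp.induction_linear with
  | zero => simp
  | add f g hf hg => simp only [map_add, hf, hg, add_smul]
  | single q e =>
    rw [wittMul_single, evalAt_single]
    rw [if_neg (by simp only [starDeg]; omega)]
    simp only [starDeg, starCoeff]
    rw [diracDeriv, Finset.sum_eq_single_of_mem 0 (by simp)
      fun b _ hb => by simp [hb]]
    rcases q with _ | q <;> simp

theorem IsEvaluation.conj {n m : ℕ} (hn : n + 2 = 2 ^ m) (hm : 2 ≤ m)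
    {T : Module.End (ZMod 2) (LStar n)} {γ : ℕ → SetRing}
    (hT : IsEvaluation T γ) (hγ : IsDividedPower γ) (c : LStarIdx n) :
    ∃ γ', IsDividedPower γ' ∧
      IsEvaluation ((1 + ad (starBasis c)) * T * (1 + ad (starBasis c))) γ' := by
  have h4 : 2 ^ 2 ≤ 2 ^ m := Nat.pow_le_pow_right (by norm_num) hm
  have hp := starDeg_le c
  have hs : starCoeff c * starCoeff c = 0 ∨ (starCoeff c = 1 ∧ starDeg c = n + 1) := by
    rcases c with _ | ⟨A, a⟩
    · exact Or.inr ⟨rfl, rfl⟩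
    · refine Or.inl (setVar_mul_of_not_disjoint ?_)
      simpa using A.2.ne_empty
  have hconj : ∀ u, toWitt n ((1 + ad (starBasis c)) u) =
      toWitt n u + wittMul (n + 1) (starDeg c) (starCoeff c) (toWitt n u) := fun u => by
    rw [LinearMap.add_apply, Module.End.one_apply, map_add, toWitt_ad_starBasis hn hm]
  generalize starCoeff c = s at hs hconj
  generalize starDeg c = p at hs hp hconj
  -- Either s² = 0, or the operator is 1 + ad(x) with p = n + 1; then the products have degree at
  -- least 2n > n + 1 and vanish.
  obtain ⟨h1, h2, h3⟩ : s * s * (γ p * delay γ p) = 0 ∧ s * s * (γ p * γ p) = 0 ∧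
      s * s * (delay γ p * delay γ p) = 0 := by
    rcases hs with hs | ⟨rfl, rfl⟩
    · simp [hs]
    · simp only [delay_succ]
      rw [hγ.mul_eq_zero hn (by omega) (by omega) (by omega),
        hγ.mul_eq_zero hn (by omega) (by omega) (by omega),
        hγ.mul_eq_zero hn (by omega) (by omega) (by omega)]
      simp
  refine ⟨translate γ (s * γ p), hγ.translate (by linear_combination h2), fun u => ?_⟩
  have hu : evalAt γ (toWitt n ((1 + ad (starBasis c)) u)) =
      (1 + s * delay γ p) * evalAt (translate γ (s * γ p)) (toWitt n u) := by
    rw [hconj]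
    induction u using Finsupp.induction_linear with
    | zero => simp
    | add f g hf hg =>
      simp only [map_add] at hf hg ⊢
      linear_combination hf + hg
    | single b t =>
      have ht : t = 0 ∨ t = 1 := by
        revert t
        decide
      rcases ht with rfl | rfl
      · simp
      change evalAt γ (toWitt n (starBasis b) + wittMul _ _ _ (toWitt n (starBasis b))) =
        _ * evalAt _ (toWitt n (starBasis b))
      rw [toWitt_starBasis]
      exact hγ.evalAt_add_wittMul hn hp h1 (starDeg_le b) _
  -- The Jacobian enters once from the evaluation and once from the Dirac derivative; its square is
  -- 1 by `h3` and characteristic two.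
  rw [Module.End.mul_apply, Module.End.mul_apply, hconj, hT, map_smul, ← smul_add, hu,
    hγ.diracDeriv_add_wittMul hn hp h1, smul_smul]
  congr 1
  linear_combination evalAt (translate γ (s * γ p)) (toWitt n u) * h3 +
    (evalAt (translate γ (s * γ p)) (toWitt n u) * s * delay γ p) *
      (CharTwo.two_eq_zero (R := SetRing))

/-! ### Products of evaluations -/

section Products

variable {R ι : Type*} [CommRing R] [Fintype ι]

/-- The additive group spanned by the products `∏ γₖ(D k)` with `D k ≤ N` and `∑ D k = t`. -/
def monomialSpan (N : ℕ) (γ : ι → ℕ → R) (t : ℕ) : AddSubgroup R :=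
  AddSubgroup.closure {x | ∃ D : ι → ℕ, (∀ k, D k ≤ N) ∧ ∑ k, D k = t ∧ x = ∏ k, γ k (D k)}

theorem monomialSpan_eq_bot {N : ℕ} {γ : ι → ℕ → R} {t : ℕ} (ht : Fintype.card ι * N < t) :
    monomialSpan N γ t = ⊥ := by
  rw [monomialSpan, AddSubgroup.closure_eq_bot_iff]
  rintro x ⟨D, hD, hsum, -⟩
  have := Finset.sum_le_card_nsmul Finset.univ D N fun k _ => hD k
  rw [hsum, smul_eq_mul, Finset.card_univ] at this
  omega

theorem one_mem_monomialSpan {N : ℕ} {γ : ι → ℕ → R} (hγ : ∀ k, IsDividedPower (γ k)) :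
    (1 : R) ∈ monomialSpan N γ 0 :=
  AddSubgroup.subset_closure ⟨0, fun _ => Nat.zero_le _, by simp, by simp [(hγ _).zero]⟩

variable [CharP R 2] {N m : ℕ} {γ : ι → ℕ → R}

/-- The new factor merges with the old one at the same point, giving an integer multiple of a
monomial, or 0 if the degree there exceeds N. -/
theorem mul_mem_monomialSpan (hN : N + 1 = 2 ^ m) (hγ : ∀ k, IsDividedPower (γ k)) (k : ι) {a : ℕ}
    (ha : a ≤ N) {t : ℕ} {x : R} (hx : x ∈ monomialSpan N γ t) :
    γ k a * x ∈ monomialSpan N γ (a + t) := by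
  classical
  induction hx using AddSubgroup.closure_induction with
  | zero => rw [mul_zero]; exact zero_mem _
  | add x y _ _ hx hy => rw [mul_add]; exact add_mem hx hy
  | neg x _ hx => rw [mul_neg]; exact neg_mem hx
  | mem x hx =>
    obtain ⟨D, hD, rfl, rfl⟩ := hx
    rw [← Finset.mul_prod_erase _ _ (Finset.mem_univ k), ← mul_assoc]
    rcases le_or_gt (a + D k) N with h | h
    · rw [(hγ k).mul, mul_assoc, ← nsmul_eq_mul]
      refine nsmul_mem (AddSubgroup.subset_closure ?_) _
      refine ⟨Function.update D k (a + D k), fun j => ?_, ?_, ?_⟩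
      · rw [Function.update_apply]
        split_ifs
        exacts [h, hD j]
      · rw [Finset.sum_update_of_mem (Finset.mem_univ k),
          ← Finset.add_sum_erase _ D (Finset.mem_univ k), Finset.sdiff_singleton_eq_erase, add_assoc]
      · rw [← Finset.mul_prod_erase _ (fun j => γ j _) (Finset.mem_univ k), Function.update_self]
        congr 1
        refine Finset.prod_congr rfl fun j hj => ?_
        rw [Function.update_of_ne (Finset.ne_of_mem_erase hj)]
    · rw [(hγ k).mul_eq_zero hN ha (hD k) h, zero_mul]
      exact zero_mem _

theorem evalAt_diracDeriv_mul_mem (hN : N + 1 = 2 ^ m) (hγ : ∀ k, IsDividedPower (γ k)) (k l : ι)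
    {t : ℕ} {x : R} (hx : x ∈ monomialSpan N γ t) :
    evalAt (γ k) (diracDeriv N (γ l)) * x ∈ monomialSpan N γ (N - 1 + t) := by
  rw [evalAt_diracDeriv, Finset.sum_mul]
  refine sum_mem fun b hb => ?_
  rw [Finset.mem_range] at hb
  rw [mul_assoc, show N - 1 + t = b + ((N - 1 - b) + t) by omega]
  exact mul_mem_monomialSpan hN hγ l (by omega) (mul_mem_monomialSpan hN hγ k (by omega) hx)

end Products

/-- Each adjacent pair of operators contributes a scalar of degree n, collected in `x`; `y` is the
value of the rightmost evaluation at `u`. -/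
theorem toWitt_prod_evaluations {n m : ℕ} (hn : n + 2 = 2 ^ m) {ι : Type*} [Fintype ι]
    {T : ι → Module.End (ZMod 2) (LStar n)} {γ : ι → ℕ → SetRing}
    (hγ : ∀ k, IsDividedPower (γ k)) (hT : ∀ k, IsEvaluation (T k) (γ k)) (u : LStar n) (k : ι)
    (l : List ι) :
    ∃ x ∈ monomialSpan (n + 1) γ (l.length * n), ∃ y,
      toWitt n (((k :: l).map T).prod u) = (x * y) • diracDeriv (n + 1) (γ k) := by
  induction l generalizing k with
  | nil =>
    refine ⟨1, by simpa using one_mem_monomialSpan hγ, evalAt (γ k) (toWitt n u), ?_⟩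
    simp [hT k u]
  | cons j l ih =>
    obtain ⟨x, hx, y, hxy⟩ := ih j
    refine ⟨evalAt (γ k) (diracDeriv (n + 1) (γ j)) * x, ?_, y, ?_⟩
    · have := evalAt_diracDeriv_mul_mem hn hγ k j hx
      rwa [Nat.add_sub_cancel, add_comm n (_ * n), ← Nat.succ_mul] at this
    · rw [List.map_cons, List.prod_cons, Module.End.mul_apply, hT k, hxy, map_smul, smul_eq_mul]
      congr 1
      ring

theorem prod_evaluations_eq_zero {n m : ℕ} (hn : n + 2 = 2 ^ m) {ι : Type*} [Fintype ι]
    {T : ι → Module.End (ZMod 2) (LStar n)} {γ : ι → ℕ → SetRing}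
    (hγ : ∀ k, IsDividedPower (γ k)) (hT : ∀ k, IsEvaluation (T k) (γ k)) (l : List ι)
    (hl : Fintype.card ι * (n + 1) + n < l.length * n) : (l.map T).prod = 0 := by
  rcases l with _ | ⟨k, l⟩
  · simp at hl
  refine LinearMap.ext fun u => toWitt_injective n ?_
  obtain ⟨x, hx, y, hxy⟩ := toWitt_prod_evaluations hn hγ hT u k l
  rw [monomialSpan_eq_bot (by rw [List.length_cons, add_mul] at hl; omega),
    AddSubgroup.mem_bot] at hx
  rw [hxy, hx, zero_mul, zero_smul, LinearMap.zero_apply, map_zero]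

/-! ### Groups generated by unipotent elements -/

section Unipotent

variable {Γ A ι : Type*} [Group Γ] [Ring A]

/-- The additive group spanned by the products of at least `j` of the elements `T k`. -/
def prodSpan (T : ι → A) (j : ℕ) : AddSubgroup A :=
  AddSubgroup.closure {x | ∃ l : List ι, j ≤ l.length ∧ x = (l.map T).prod}

theorem prodSpan_anti (T : ι → A) : Antitone (prodSpan T) := fun _ _ h =>
  AddSubgroup.closure_mono fun _ ⟨l, hl, hx⟩ => ⟨l, h.trans hl, hx⟩

theorem mul_mem_prodSpan {T : ι → A} {i j : ℕ} {x y : A} (hx : x ∈ prodSpan T i)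
    (hy : y ∈ prodSpan T j) : x * y ∈ prodSpan T (i + j) := by
  induction hx using AddSubgroup.closure_induction with
  | zero => rw [zero_mul]; exact zero_mem _
  | add a b _ _ ha hb => rw [add_mul]; exact add_mem ha hb
  | neg a _ ha => rw [neg_mul]; exact neg_mem ha
  | mem a ha =>
    induction hy using AddSubgroup.closure_induction with
    | zero => rw [mul_zero]; exact zero_mem _
    | add b c _ _ hb hc => rw [mul_add]; exact add_mem hb hc
    | neg b _ hb => rw [mul_neg]; exact neg_mem hb
    | mem b hb =>
      obtain ⟨l, hl, rfl⟩ := ha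
      obtain ⟨l', hl', rfl⟩ := hb
      exact AddSubgroup.subset_closure ⟨l ++ l', by rw [List.length_append]; omega, by simp⟩

/-- The elements of `Γ` that are congruent to `1` modulo `prodSpan T j`. -/
def congrSubgroup (ρ : Γ →* A) (T : ι → A) (j : ℕ) : Subgroup Γ where
  carrier := {g | ρ g - 1 ∈ prodSpan T j ∧ ρ g⁻¹ - 1 ∈ prodSpan T j}
  one_mem' := by simp [zero_mem]
  inv_mem' h := by simpa [and_comm] using h
  mul_mem' := by
    have key : ∀ a b : Γ, ρ a - 1 ∈ prodSpan T j → ρ b - 1 ∈ prodSpan T j →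
        ρ (a * b) - 1 ∈ prodSpan T j := fun a b ha hb => by
      have : ρ (a * b) - 1 = (ρ a - 1) * (ρ b - 1) + (ρ a - 1) + (ρ b - 1) := by
        rw [map_mul]
        noncomm_ring
      rw [this]
      exact add_mem (add_mem (prodSpan_anti T (Nat.le_add_left j j) (mul_mem_prodSpan ha hb)) ha) hb
    rintro a b ⟨ha, ha'⟩ ⟨hb, hb'⟩
    refine ⟨key a b ha hb, ?_⟩
    rw [mul_inv_rev]
    exact key _ _ hb' ha'

theorem map_commutatorElement_sub_one (ρ : Γ →* A) (a b : Γ) :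
    ρ ⁅a, b⁆ - 1 = ((ρ a - 1) * (ρ b - 1) - (ρ b - 1) * (ρ a - 1)) * (ρ (a⁻¹ * b⁻¹) - 1) +
      ((ρ a - 1) * (ρ b - 1) - (ρ b - 1) * (ρ a - 1)) := by
  have h2 : (ρ b * ρ a) * ρ (a⁻¹ * b⁻¹) = 1 := by
    rw [← map_mul, ← map_mul, ← map_one ρ]
    congr 1
    group
  have h3 : ρ ⁅a, b⁆ = (ρ a * ρ b) * ρ (a⁻¹ * b⁻¹) := by
    rw [← map_mul, ← map_mul, commutatorElement_def]
    congr 1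
    group
  have h5 : (ρ a - 1) * (ρ b - 1) - (ρ b - 1) * (ρ a - 1) = ρ a * ρ b - ρ b * ρ a := by
    simp only [sub_mul, mul_sub, mul_one, one_mul]
    abel
  rw [h5, mul_sub, mul_one, sub_add_cancel, sub_mul, h2, h3]

theorem map_commutatorElement_sub_one_mem {ρ : Γ →* A} {T : ι → A} {i j : ℕ} {a b : Γ}
    (ha : a ∈ congrSubgroup ρ T i) (hb : b ∈ congrSubgroup ρ T j) :
    ρ ⁅a, b⁆ - 1 ∈ prodSpan T (i + j) := by
  have h0 : ∀ {i : ℕ} {g : Γ}, g ∈ congrSubgroup ρ T i → g ∈ congrSubgroup ρ T 0 :=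
    fun h => ⟨prodSpan_anti T (Nat.zero_le _) h.1, prodSpan_anti T (Nat.zero_le _) h.2⟩
  have h1 : (ρ a - 1) * (ρ b - 1) - (ρ b - 1) * (ρ a - 1) ∈ prodSpan T (i + j) := by
    refine sub_mem (mul_mem_prodSpan ha.1 hb.1) ?_
    rw [add_comm]
    exact mul_mem_prodSpan hb.1 ha.1
  have h2 : a⁻¹ * b⁻¹ ∈ congrSubgroup ρ T 0 := mul_mem (inv_mem (h0 ha)) (inv_mem (h0 hb))
  rw [map_commutatorElement_sub_one]
  exact add_mem (mul_mem_prodSpan (j := 0) h1 h2.1) h1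

theorem commutator_mem_congrSubgroup {ρ : Γ →* A} {T : ι → A} {i j : ℕ} {a b : Γ}
    (ha : a ∈ congrSubgroup ρ T i) (hb : b ∈ congrSubgroup ρ T j) :
    ⁅a, b⁆ ∈ congrSubgroup ρ T (i + j) := by
  refine ⟨map_commutatorElement_sub_one_mem ha hb, ?_⟩
  rw [commutatorElement_inv, add_comm]
  exact map_commutatorElement_sub_one_mem hb ha

/-- Term `j` of the series, counted from 0, is congruent to 1 modulo products of at least j + 1 of
the `T k`. -/
theorem lowerCentralSeries_closure_eq_bot {ρ : Γ →* A} (hρ : Function.Injective ρ) {T : ι → A}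
    {h : ι → Γ} (hT : ∀ k, ρ (h k) = 1 + T k) (hinv : ∀ k, (h k)⁻¹ = h k) {c : ℕ}
    (hc : ∀ l : List ι, c < l.length → (l.map T).prod = 0) :
    (Subgroup.closure (Set.range h)).lowerCentralSeries c = ⊥ := by
  have h1 : Subgroup.closure (Set.range h) ≤ congrSubgroup ρ T 1 := by
    rw [Subgroup.closure_le]
    rintro _ ⟨k, rfl⟩
    have : ρ (h k) - 1 ∈ prodSpan T 1 := by
      rw [hT, add_sub_cancel_left]
      exact AddSubgroup.subset_closure ⟨[k], by simp, by simp⟩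
    refine ⟨this, ?_⟩
    rw [hinv]
    exact this
  have h2 : ∀ j, (Subgroup.closure (Set.range h)).lowerCentralSeries j ≤
      congrSubgroup ρ T (j + 1) := by
    intro j
    induction j with
    | zero => exact h1
    | succ j ih =>
      rw [Subgroup.lowerCentralSeries_succ, Subgroup.commutator_le]
      exact fun a ha b hb => commutator_mem_congrSubgroup (ih ha) (h1 hb)
  have h3 : prodSpan T (c + 1) = ⊥ := by
    rw [prodSpan, AddSubgroup.closure_eq_bot_iff]
    rintro x ⟨l, hl, rfl⟩
    exact hc l hl
  rw [eq_bot_iff]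
  intro g hg
  have := (h2 c hg).1
  rw [h3, AddSubgroup.mem_bot, sub_eq_zero, ← map_one ρ] at this
  exact Subgroup.mem_bot.mpr (hρ this)

theorem isNilpotent_and_nilpotencyClass_le {H : Subgroup Γ} {c : ℕ}
    (h : H.lowerCentralSeries c = ⊥) : Group.IsNilpotent H ∧ Group.nilpotencyClass H ≤ c := by
  have h1 : (⊤ : Subgroup H).lowerCentralSeries c = ⊥ := by
    rw [← Subgroup.map_subtype_inj, Subgroup.map_bot, Subgroup.top_subtype_lowerCentralSeries, h]
  have h2 : Group.IsNilpotent H := (Subgroup.isNilpotent_iff_lowerCentralSeries H).mpr ⟨c, h⟩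
  exact ⟨h2, Subgroup.lowerCentralSeries_eq_bot_iff_nilpotencyClass_le.mp h1⟩

end Unipotent

/-! ### Conjugates of `1 + ad(x)` -/

/-- Both directions of conjugation are carried along so that the inverse case of the induction just
swaps them. -/
theorem isEvaluation_conj_of_mem {n m : ℕ} (hn : n + 2 = 2 ^ m) (hm : 2 ≤ m)
    {g : LinearMap.GeneralLinearGroup (ZMod 2) (LStar n)} (hg : g ∈ G n)
    (T : Module.End (ZMod 2) (LStar n)) (hT : ∃ γ, IsDividedPower γ ∧ IsEvaluation T γ) :
    (∃ γ, IsDividedPower γ ∧ IsEvaluation ((g⁻¹).val * T * g.val) γ) ∧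
      ∃ γ, IsDividedPower γ ∧ IsEvaluation (g.val * T * (g⁻¹).val) γ := by
  induction hg using Subgroup.closure_induction generalizing T with
  | mem g hg =>
    obtain ⟨c, rfl⟩ := hg
    obtain ⟨γ, hγ, hT⟩ := hT
    exact ⟨hT.conj hn hm hγ c, hT.conj hn hm hγ c⟩
  | one => simpa using hT
  | inv g _ ih =>
    rw [inv_inv]
    exact (ih T hT).symm
  | mul g g' _ _ ih ih' =>
    rw [mul_inv_rev, Units.val_mul, Units.val_mul]
    have h1 := (ih' _ (ih T hT).1).1
    have h2 := (ih _ (ih' T hT).2).2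
    simp only [mul_assoc] at h1 h2 ⊢
    exact ⟨h1, h2⟩

theorem lowerCentralSeries_closure_conj_eq_bot {n m : ℕ} (hn : n + 2 = 2 ^ m) (hm : 2 ≤ m) (r : ℕ)
    (g : Fin r → G n) :
    (Subgroup.closure (Set.range fun k => (g k)⁻¹ * oneAddAdX n * g k)).lowerCentralSeries
      (4 * r + 1) = ⊥ := by
  have h4 : 2 ^ 2 ≤ 2 ^ m := Nat.pow_le_pow_right (by norm_num) hm
  have hev := fun k => (isEvaluation_conj_of_mem hn hm (g k).2 _
    ⟨_, isDividedPower_single, isEvaluation_ad_x hn hm⟩).1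
  choose γ hγ hT using hev
  refine lowerCentralSeries_closure_eq_bot (A := Module.End (ZMod 2) (LStar n))
    (ρ := (Units.coeHom (Module.End (ZMod 2) (LStar n))).comp (G n).subtype)
    (T := fun k => ((g k).1⁻¹).val * ad (starBasis none) * (g k).1.val)
    (fun a b h => Subtype.ext (Units.ext h)) ?_ ?_ ?_
  · intro k
    change ((g k).1⁻¹).val * (1 + ad (starBasis none)) * (g k).1.val = _
    rw [mul_add, mul_one, add_mul, Units.inv_mul]
  · intro k
    have : (oneAddAdX n)⁻¹ = oneAddAdX n := rfl
    rw [mul_inv_rev, mul_inv_rev, inv_inv, this, mul_assoc]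
  · intro l hl
    refine prod_evaluations_eq_zero hn hγ hT l ?_
    rw [Fintype.card_fin]
    -- r (n + 1) + n < (4r + 2) n holds with room to spare, since n ≥ 2.
    have h5 : (4 * r + 2) * n ≤ l.length * n := Nat.mul_le_mul_right n hl
    have h6 : r * 2 ≤ r * n := Nat.mul_le_mul_left r (by omega)
    nlinarith

/-! ### Commutators of the generators -/

section Witt

variable {R : Type*} [CommRing R]

theorem wittMul_eq_smul (N p : ℕ) (s : R) : wittMul N p s = s • wittMul N p 1 := by
  refine Finsupp.lhom_ext fun q e => ?_
  rw [LinearMap.smul_apply, wittMul_single, wittMul_single]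
  split_ifs
  · rw [smul_zero]
  · rw [Finsupp.smul_single, smul_eq_mul]
    congr 1
    ring

theorem wittMul_wittMul_wittMul (N p p' : ℕ) {s : R} (hs : s * s = 0) (t : R) (f : ℕ →₀ R) :
    wittMul N p s (wittMul N p' t (wittMul N p s f)) = 0 := by
  rw [wittMul_eq_smul N p s]
  simp only [LinearMap.smul_apply, map_smul]
  rw [smul_smul, hs, zero_smul]

/-- Multiplication by f(N) kills every f(k) with k > 0, and after the first two steps the index is
at least N - 2 > 0. -/
theorem wittMul_top_wittMul_zero_wittMul_top {N : ℕ} (hN : 3 ≤ N) (s t : R) (f : ℕ →₀ R) :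
    wittMul N N s (wittMul N 0 t (wittMul N N s f)) = 0 := by
  induction f using Finsupp.induction_linear with
  | zero => simp
  | add f g hf hg => simp only [map_add, hf, hg, add_zero]
  | single q e =>
    rw [wittMul_single, if_neg (by omega), wittMul_single, if_neg (by omega), wittMul_single,
      if_neg (by omega), Nat.choose_eq_zero_of_lt (k := q + N - 1 + 0 - 1) (by omega)]
    simp

/-- The Jacobi identity for f(p + 1) f(0) = f(p). It reduces to Pascal's rule because all C(N, k)
with k ≤ N are odd. -/
theorem wittMul_zero_comm [CharP R 2] {N m p : ℕ} (hN : N + 1 = 2 ^ m) (hp : p + 1 ≤ N) (s t : R)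
    (f : ℕ →₀ R) :
    wittMul N p (s * t) f =
      wittMul N (p + 1) s (wittMul N 0 t f) + wittMul N 0 t (wittMul N (p + 1) s f) := by
  have hodd : ∀ k ≤ N, ((N.choose k : ℕ) : R) = 1 := fun k hk => by
    simpa using cast_choose_sub (R := R) hN (p := 0) (Nat.zero_le _) hk
  induction f using Finsupp.induction_linear with
  | zero => simp
  | add f g hf hg =>
    simp only [map_add, hf, hg]
    abel
  | single q e =>
    have hC : ∀ k, (((N - (p + 1)).choose k : ℕ) : R) * (N.choose (k + p) : ℕ) =
        ((N - (p + 1)).choose k : ℕ) := fun k => by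
      rcases le_or_gt k (N - (p + 1)) with h | h
      · rw [hodd _ (by omega), mul_one]
      · rw [Nat.choose_eq_zero_of_lt h]
        simp
    rw [wittMul_single, wittMul_single, wittMul_single, if_neg (show q + (p + 1) ≠ 0 by omega),
      wittMul_single, Nat.sub_zero, show q + (p + 1) - 1 + 0 = q + p by omega,
      show q + (p + 1) - 1 = q + p by omega]
    rcases q with _ | q
    · simp only [add_zero, if_true, map_zero, zero_add]
      rcases p with _ | p
      · simp
      · have := hC 0
        rw [zero_add] at this
        rw [if_neg (by omega), if_neg (by omega)]
        congr 1
        rw [Nat.choose_zero_right, Nat.cast_one, one_mul] at this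
        rw [this, Nat.choose_zero_right, Nat.choose_zero_right]
        ring
    · rw [if_neg (by omega), if_neg (by omega), if_neg (by omega), wittMul_single,
        if_neg (by omega), show q + 1 + 0 - 1 + (p + 1) - 1 = q + 1 + p - 1 by omega,
        ← Finsupp.single_add]
      congr 1
      rcases le_or_gt (q + 1) N with h | h
      · rw [hodd _ h, show q + 1 + 0 - 1 = q by omega, show N - p = N - (p + 1) + 1 by omega,
          Nat.choose_succ_succ]
        push_cast
        linear_combination (- e * s * t) * hC (q + 1)
      · rw [Nat.choose_eq_zero_of_lt h, Nat.choose_eq_zero_of_lt (show N - p < q + 1 by omega),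
          Nat.choose_eq_zero_of_lt (show N - (p + 1) < q + 1 by omega)]
        simp

end Witt

theorem commutator_one_add {A : Type*} [Ring A] [CharP A 2] {a b : A} (ha : a * a = 0)
    (hb : b * b = 0) (haba : a * b * a = 0) (hbab : b * a * b = 0) :
    (1 + a) * (1 + b) * (1 + a) * (1 + b) = 1 + (a * b + b * a) := by
  have h1 : (1 + a) * (1 + b) * (1 + a) = 1 + b + (a * b + b * a) := by
    have : (1 + a) * (1 + b) * (1 + a) =
        1 + b + (a * b + b * a) + (a + a) + a * a + a * b * a := by noncomm_ring
    rw [this, ha, haba, CharTwo.add_self_eq_zero, add_zero, add_zero, add_zero]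
  have h2 : (1 + b + (a * b + b * a)) * (1 + b) =
      1 + (a * b + b * a) + (b + b) + b * b + a * (b * b) + b * a * b := by noncomm_ring
  rw [h1, h2, hb, hbab, CharTwo.add_self_eq_zero, mul_zero, add_zero, add_zero, add_zero, add_zero]

/-- The element `1 + ad(b)` of `G`. -/
def gen {n : ℕ} (b : LStarIdx n) : G n := ⟨oneAddAd b, Subgroup.subset_closure ⟨b, rfl⟩⟩

theorem gen_inv {n : ℕ} (b : LStarIdx n) : (gen b)⁻¹ = gen b := rfl

theorem commutator_gen {n m : ℕ} (hn : n + 2 = 2 ^ m) (hm : 2 ≤ m) {b c d : LStarIdx n}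
    (hc : starDeg c = 0) (hbd : starDeg b = starDeg d + 1)
    (hd : starCoeff d = starCoeff b * starCoeff c) (hcc : starCoeff c * starCoeff c = 0)
    (hbb : starCoeff b * starCoeff b = 0 ∨ starDeg b = n + 1) : ⁅gen b, gen c⁆ = gen d := by
  have h4 : 2 ^ 2 ≤ 2 ^ m := Nat.pow_le_pow_right (by norm_num) hm
  have h2 : CharP (Module.End (ZMod 2) (LStar n)) 2 := by
    refine CharTwo.of_one_ne_zero_of_two_eq_zero (fun h => ?_) ?_
    · have := DFunLike.congr_fun h (starBasis none)
      simp [starBasis] at this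
    · have := map_ofNat (algebraMap (ZMod 2) (Module.End (ZMod 2) (LStar n))) 2
      rw [← this, show (OfNat.ofNat 2 : ZMod 2) = 0 from rfl, map_zero]
  rw [commutatorElement_def, gen_inv, gen_inv]
  refine Subtype.ext (Units.ext ?_)
  change (1 + ad (starBasis b)) * (1 + ad (starBasis c)) * (1 + ad (starBasis b)) *
    (1 + ad (starBasis c)) = 1 + ad (starBasis d)
  refine (commutator_one_add (A := Module.End (ZMod 2) (LStar n)) (ad_basis_sq b) (ad_basis_sq c)
    ?_ ?_).trans ?_
  rotate_left 2
  · congr 1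
    refine LinearMap.ext fun u => toWitt_injective n ?_
    have hb := starDeg_le b
    rw [LinearMap.add_apply, Module.End.mul_apply, Module.End.mul_apply, map_add]
    simp only [toWitt_ad_starBasis hn hm]
    rw [hc, hbd, hd]
    exact (wittMul_zero_comm hn (by omega) _ _ _).symm
  · refine LinearMap.ext fun u => toWitt_injective n ?_
    rw [Module.End.mul_apply, Module.End.mul_apply, LinearMap.zero_apply, map_zero]
    simp only [toWitt_ad_starBasis hn hm]
    rcases hbb with hbb | hbb
    · exact wittMul_wittMul_wittMul _ _ _ hbb _ _
    · rw [hbb, hc]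
      exact wittMul_top_wittMul_zero_wittMul_top (by omega) _ _ _
  · refine LinearMap.ext fun u => toWitt_injective n ?_
    rw [Module.End.mul_apply, Module.End.mul_apply, LinearMap.zero_apply, map_zero]
    simp only [toWitt_ad_starBasis hn hm]
    exact wittMul_wittMul_wittMul _ _ _ hcc _ _

theorem setVar_mul_self (A : NESet) : setVar A.1 * setVar A.1 = 0 :=
  setVar_mul_of_not_disjoint (by simpa using A.2.ne_empty)

/-! ### The normal closure of `1 + ad(x)` -/

theorem exists_disjoint_union_of_infinite {A : Set ℕ} (hA : A.Infinite) :
    ∃ B C : Set ℕ, B.Infinite ∧ C.Infinite ∧ Disjoint B C ∧ B ∪ C = A := by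
  obtain ⟨B, C, hBC, hdisj, hcard⟩ := hA.exists_union_disjoint_cardinal_eq_of_infinite
  have hfin : B.Finite ↔ C.Finite := by
    rw [← Cardinal.lt_aleph0_iff_set_finite, hcard, Cardinal.lt_aleph0_iff_set_finite]
  rw [← hBC, Set.infinite_union, Set.Infinite, Set.Infinite, hfin, or_self] at hA
  exact ⟨B, C, fun h => hA (hfin.mp h), hA, hdisj, hBC⟩

theorem commutator_mem_of_mem_normal {Γ : Type*} [Group Γ] {H : Subgroup Γ} (hH : H.Normal)
    {a : Γ} (ha : a ∈ H) (b : Γ) : ⁅a, b⁆ ∈ H := by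
  rw [commutatorElement_def, mul_assoc, mul_assoc, ← mul_assoc b]
  exact mul_mem ha (hH.conj_mem _ (inv_mem ha) b)

/-- Starting from x · w = v(0), each further product with w raises the index of v by one and finally
gives w. Each such step needs a fresh disjoint set, hence the infinite `A`. -/
theorem gen_mem_normalClosure {n m : ℕ} (hn : n + 2 = 2 ^ m) (hm : 2 ≤ m) (k : ℕ) :
    ∀ (d : WIdx n) (A : NESet), A.1.Infinite → starDeg (some (A, d)) + k = n →
      gen (some (A, d)) ∈ Subgroup.normalClosure {oneAddAdX n} := by
  have hN : (Subgroup.normalClosure {oneAddAdX n}).Normal := Subgroup.normalClosure_normal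
  induction k with
  | zero =>
    intro d A hA hd
    have := commutator_gen hn hm (b := none) (c := some (A, WIdx.w)) (d := some (A, d)) rfl
      (congrArg (· + 1) hd.symm) (one_mul _).symm (setVar_mul_self A) (Or.inr rfl)
    rw [← this]
    exact commutator_mem_of_mem_normal hN (Subgroup.subset_normalClosure rfl) _
  | succ k ih =>
    intro d A hA hd
    obtain ⟨B, C, hB, hC, hBC, hA'⟩ := exists_disjoint_union_of_infinite hA
    obtain ⟨i, hi⟩ : ∃ i : Fin n, n - i = starDeg (some (A, d)) + 1 :=
      ⟨⟨k, by omega⟩, by dsimp only; omega⟩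
    have := commutator_gen hn hm (b := some (⟨B, hB.nonempty⟩, WIdx.v i))
      (c := some (⟨C, hC.nonempty⟩, WIdx.w)) (d := some (A, d)) rfl hi
      (by simp only [starCoeff]; rw [setVar_mul_of_disjoint hBC, hA'])
      (setVar_mul_self _) (Or.inl (setVar_mul_self _))
    rw [← this]
    refine commutator_mem_of_mem_normal hN (ih _ _ hB ?_) _
    change n - i + k = n
    omega

theorem gen_mem_lowerCentralSeries {n m : ℕ} (hn : n + 2 = 2 ^ m) (hm : 2 ≤ m) (c : ℕ) :
    ∀ A : NESet, A.1.Infinite → gen (some (A, WIdx.w)) ∈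
      (Subgroup.normalClosure {oneAddAdX n}).lowerCentralSeries c := by
  have h4 : 2 ^ 2 ≤ 2 ^ m := Nat.pow_le_pow_right (by norm_num) hm
  induction c with
  | zero => exact fun A hA => gen_mem_normalClosure hn hm n _ A hA (zero_add n)
  | succ c ih =>
    intro A hA
    obtain ⟨B, C, hB, hC, hBC, hA'⟩ := exists_disjoint_union_of_infinite hA
    have hi : n - ((⟨n - 1, by omega⟩ : Fin n) : ℕ) = 1 := by
      dsimp only
      omega
    have := commutator_gen hn hm (b := some (⟨B, hB.nonempty⟩, WIdx.v ⟨n - 1, by omega⟩))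
      (c := some (⟨C, hC.nonempty⟩, WIdx.w)) (d := some (A, WIdx.w)) rfl hi
      (by simp only [starCoeff]; rw [setVar_mul_of_disjoint hBC, hA'])
      (setVar_mul_self _) (Or.inl (setVar_mul_self _))
    -- v(n-1)_B · w_C = w_A. The generators are involutions, so inverting the commutator puts the
    -- entry from the series, w_C, first.
    rw [← gen_inv, ← this, commutatorElement_inv, Subgroup.lowerCentralSeries_succ]
    refine Subgroup.commutator_mem_commutator (ih _ hC)
      (gen_mem_normalClosure hn hm (n - 1) _ _ hB ?_)
    change n - (n - 1) + (n - 1) = n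
    omega

/-- Its action on x shows it: x · w_A = v(0)_A is not zero. -/
theorem gen_w_ne_one {n m : ℕ} (hn : n + 2 = 2 ^ m) (hm : 2 ≤ m) (A : NESet) :
    gen (some (A, (WIdx.w : WIdx n))) ≠ 1 := by
  intro h
  have h1 : (1 + ad (starBasis (some (A, (WIdx.w : WIdx n))))) = 1 :=
    congrArg (fun g : G n => g.1.val) h
  have h2 := toWitt_ad_starBasis hn hm (some (A, WIdx.w)) (starBasis none)
  have h0 : ad (starBasis (some (A, (WIdx.w : WIdx n)))) = 0 := by
    refine LinearMap.ext fun u => ?_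
    simpa using DFunLike.congr_fun h1 u
  rw [h0, LinearMap.zero_apply, map_zero, toWitt_starBasis, wittMul_single,
    if_neg (by simp [starDeg])] at h2
  have h3 := congrArg (setCoeff A.1) (Finsupp.single_eq_zero.mp h2.symm)
  simp [starDeg, starCoeff, setCoeff_setVar] at h3

theorem not_isNilpotent_normalClosure {n m : ℕ} (hn : n + 2 = 2 ^ m) (hm : 2 ≤ m) :
    ¬ Group.IsNilpotent (Subgroup.normalClosure {oneAddAdX n}) := by
  rw [Subgroup.isNilpotent_iff_lowerCentralSeries]
  rintro ⟨c, hc⟩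
  have := gen_mem_lowerCentralSeries hn hm c ⟨Set.univ, Set.univ_nonempty⟩ Set.infinite_univ
  rw [hc, Subgroup.mem_bot] at this
  exact gen_w_ne_one hn hm _ this

end EngelLie
end

theorem proposition3p9 (m : ℕ) (hm : 2 ≤ m) :
    (∀ (r : ℕ) (g : Fin r → EngelLie.G (2 ^ m - 2))
        (H : Subgroup (EngelLie.G (2 ^ m - 2))),
        H = Subgroup.closure
          (Set.range fun k : Fin r => (g k)⁻¹ * EngelLie.oneAddAdX (2 ^ m - 2) * g k) →
        Group.IsNilpotent H ∧ Group.nilpotencyClass H ≤ 4 * r + 1) ∧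
      ¬ Group.IsNilpotent
          (Subgroup.normalClosure ({EngelLie.oneAddAdX (2 ^ m - 2)} :
            Set (EngelLie.G (2 ^ m - 2)))) := by
  have h4 : 2 ^ 2 ≤ 2 ^ m := Nat.pow_le_pow_right (by norm_num) hm
  have hn : 2 ^ m - 2 + 2 = 2 ^ m := by omega
  refine ⟨?_, EngelLie.not_isNilpotent_normalClosure hn hm⟩
  rintro r g H rfl
  exact EngelLie.isNilpotent_and_nilpotencyClass_le
    (EngelLie.lowerCentralSeries_closure_conj_eq_bot hn hm r g)
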